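/- Let $F:\mathbb{R}^n\rightrightarrows\mathbb{R}^n$ be an $L$-Lipschitz set-valued mapping with nonempty, convex and compact values, that is, $F(x)\subset F(y)+\mathrm{B}(0,L\|x-y\|)$ for all $x,y\in\mathbb{R}^n$, where $\mathrm{B}(0,r)$ is the closed ball of radius $r$ centred at the origin. Let $A:\mathbb{R}^n\rightrightarrows\mathbb{R}^n$ be a maximal monotone operator, let $\operatorname{dom}A=\{x\in\mathbb{R}^n : A(x)\neq\emptyset\}$, and let $x_0\in\mathbb{R}^n$. A continuous function $x:[0,\infty)\to\mathbb{R}^n$ is called a solution of $$\dot x(t)\in F(x(t))-A(x(t))\ \text{ for a.e. } t\ge 0,\qquad x(0)=x_0\in\overline{\operatorname{dom}A},\qquad(1)$$ if it is absolutely continuous on every compact subset of $(0,\infty)$ (equivalently, on every interval $[a,b]$ with $0<a\le b<\infty$) and satisfies $(1)$. Then a continuous function $x:[0,\infty)\to\mathbb{R}^n$ is a solution of $(1)$ if and only if $x(\cdot)$ is absolutely continuous on every compact subset of $(0,\infty)$ and, for every $T>0$, there exists a function $f\in L^\infty(0,T;\mathbb{R}^n)$ with $f(t)\in F(x(t))$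 for a.e. $t\in[0,T]$ such that $$\dot x(t)\in f(t)-A(x(t))\ \text{ for a.e. } t\in[0,T],\qquad x(0)=x_0\in\overline{\operatorname{dom}A}.$$ -/

import Mathlib

open Set MeasureTheory
open scoped NNReal ENNReal Pointwise

namespace MonotoneInclusion

/-- The domain of a multivalued operator: the points with a nonempty value. -/
def dom {n : ℕ} (A : EuclideanSpace ℝ (Fin n) → Set (EuclideanSpace ℝ (Fin n))) :
    Set (EuclideanSpace ℝ (Fin n)) :=
  {x | (A x).Nonempty}

/-- The graph of a multivalued operator. -/
def graph {n : ℕ} (A : EuclideanSpace ℝ (Fin n) → Set (EuclideanSpace ℝ (Fin n))) :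
    Set (EuclideanSpace ℝ (Fin n) × EuclideanSpace ℝ (Fin n)) :=
  {p | p.2 ∈ A p.1}

/-- Monotonicity of a multivalued operator. -/
def IsMonotone {n : ℕ} (A : EuclideanSpace ℝ (Fin n) → Set (EuclideanSpace ℝ (Fin n))) : Prop :=
  ∀ p ∈ graph A, ∀ q ∈ graph A, 0 ≤ inner ℝ (p.2 - q.2) (p.1 - q.1)

/-- Maximal monotonicity: monotone, and the graph is not properly contained in the graph of
another monotone operator. -/
def IsMaximalMonotone {n : ℕ}
    (A : EuclideanSpace ℝ (Fin n) → Set (EuclideanSpace ℝ (Fin n))) : Prop :=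
  IsMonotone A ∧
    ∀ B : EuclideanSpace ℝ (Fin n) → Set (EuclideanSpace ℝ (Fin n)),
      IsMonotone B → ¬ graph A ⊂ graph B

/-- An `L`-Lipschitz multifunction with nonempty, convex and compact values. -/
structure IsLipschitzCusco {n : ℕ} (L : ℝ≥0)
    (F : EuclideanSpace ℝ (Fin n) → Set (EuclideanSpace ℝ (Fin n))) : Prop where
  nonempty : ∀ x, (F x).Nonempty
  convex : ∀ x, Convex ℝ (F x)
  isCompact : ∀ x, IsCompact (F x)
  lipschitz : ∀ x y, F x ⊆ F y + Metric.closedBall 0 (L * ‖x - y‖)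

/-- Absolute continuity on every compact subinterval of `(0, ∞)` (a function that is absolutely
continuous on an interval is so on each of its subsets, hence this is the same as absolute
continuity on every compact subset of `(0, ∞)`). -/
def LocallyAbsolutelyContinuous {n : ℕ} (x : ℝ → EuclideanSpace ℝ (Fin n)) : Prop :=
  ∀ a b : ℝ, 0 < a → a ≤ b → AbsolutelyContinuousOnInterval x a b

/-- `x` is a solution of `x'(t) ∈ F(x(t)) - A(x(t))` for a.e. `t ≥ 0`,
`x(0) = x₀ ∈ closure (dom A)`. Functions on `[0, ∞)` are represented by functions on `ℝ`, whose
values at negative arguments play no role. -/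
structure IsSolution {n : ℕ} (F A : EuclideanSpace ℝ (Fin n) → Set (EuclideanSpace ℝ (Fin n)))
    (x₀ : EuclideanSpace ℝ (Fin n)) (x : ℝ → EuclideanSpace ℝ (Fin n)) : Prop where
  continuousOn : ContinuousOn x (Ici 0)
  absolutelyContinuous : LocallyAbsolutelyContinuous x
  inclusion : ∀ᵐ t ∂(volume.restrict (Ici (0 : ℝ))),
    DifferentiableAt ℝ x t ∧ deriv x t ∈ F (x t) - A (x t)
  initial : x 0 = x₀
  initial_mem : x₀ ∈ closure (dom A)

end MonotoneInclusion

namespace MonotoneInclusion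

/-! Only measurability and boundedness of `f` are at stake. A velocity `v` at `y` is admissible iff
`F y ∩ (v + A y)` is nonempty; this set is convex and depends on `(y, v)` through a closed graph.
Its element of minimal norm is thus a Borel function of `(y, v)` (`exists_measurable_selection`),
and composing with `(x, deriv x)` gives `f`. On `[0, T]` the trajectory is bounded, so `F` is
bounded along it (`IsLipschitzCusco.exists_norm_le`). Conversely, countably many intervals cover
`[0, ∞)`. -/

/-- The points over which a closed set meets a compact set form a closed set. -/
lemma isClosed_setOf_exists_mem_isCompact {P V : Type*} [TopologicalSpace P] [TopologicalSpace V]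
    {K : Set (P × V)} (hK : IsClosed K) {C : Set V} (hC : IsCompact C) :
    IsClosed {p | ∃ f ∈ C, (p, f) ∈ K} := by
  have : CompactSpace C := isCompact_iff_compactSpace.mp hC
  have h1 : IsClosed {q : P × C | (q.1, (q.2 : V)) ∈ K} := hK.preimage (by fun_prop)
  convert isClosedMap_fst_of_compactSpace _ h1 using 1
  ext p
  simp

/-- A closed convex nonempty set has an element of minimal norm, characterised by a variational
inequality. -/
lemma exists_forall_inner_sub_nonneg {V : Type*} [NormedAddCommGroup V] [InnerProductSpace ℝ V]
    [CompleteSpace V] {S : Set V} (hS : IsClosed S) (hc : Convex ℝ S) (hne : S.Nonempty) :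
    ∃ m ∈ S, ∀ w ∈ S, 0 ≤ inner ℝ m (w - m) := by
  obtain ⟨m, hm, h⟩ := exists_norm_eq_iInf_of_complete_convex hne hS.isComplete hc 0
  refine ⟨m, hm, fun w hw => ?_⟩
  have := (norm_eq_iInf_iff_real_inner_le_zero hc hm).1 h w hw
  rw [zero_sub, inner_neg_left] at this
  linarith

lemma norm_le_of_inner_sub_nonneg {V : Type*} [NormedAddCommGroup V] [InnerProductSpace ℝ V]
    {m w : V} (h : 0 ≤ inner ℝ m (w - m)) : ‖m‖ ≤ ‖w‖ := by
  rw [inner_sub_right, real_inner_self_eq_norm_sq] at h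
  have := real_inner_le_norm m w
  by_contra! hlt
  nlinarith [norm_nonneg m, norm_nonneg w]

/-- Uniqueness of the minimal-norm element: expanding the square gives `‖w - m‖ ^ 2 ≤ ‖w‖ ^ 2 - ‖m‖
^ 2`. -/
lemma eq_of_inner_sub_nonneg {V : Type*} [NormedAddCommGroup V] [InnerProductSpace ℝ V]
    {m w : V} (h : 0 ≤ inner ℝ m (w - m)) (hw : ‖w‖ ≤ ‖m‖) : w = m := by
  rw [inner_sub_right, real_inner_self_eq_norm_sq] at h
  have h2 := norm_sub_sq_real w m
  rw [real_inner_comm] at h2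
  have : ‖w - m‖ ^ 2 ≤ 0 := by nlinarith [norm_nonneg w]
  exact sub_eq_zero.1 (norm_eq_zero.1 (pow_eq_zero_iff two_ne_zero |>.1
    (le_antisymm this (sq_nonneg _))))

/-- A closed subset of a product with convex sections in a finite-dimensional space admits a
Borel measurable selection, namely the one of minimal norm. -/
theorem exists_measurable_selection {P V : Type*} [TopologicalSpace P] [MeasurableSpace P]
    [BorelSpace P] [NormedAddCommGroup V] [InnerProductSpace ℝ V]
    [FiniteDimensional ℝ V] [MeasurableSpace V] [BorelSpace V] {K : Set (P × V)}
    (hK : IsClosed K) (hc : ∀ p, Convex ℝ {f | (p, f) ∈ K}) :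
    ∃ m : P → V, Measurable m ∧ ∀ p, (∃ f, (p, f) ∈ K) → (p, m p) ∈ K := by
  classical
  have : ProperSpace V := FiniteDimensional.proper ℝ V
  have hsec : ∀ p, IsClosed {f | (p, f) ∈ K} := fun p => hK.preimage (by fun_prop)
  have hex : ∀ p, ∃ m : V, ((∃ f, (p, f) ∈ K) →
      (p, m) ∈ K ∧ ∀ w, (p, w) ∈ K → 0 ≤ inner ℝ m (w - m)) ∧
      ((¬ ∃ f, (p, f) ∈ K) → m = 0) := by
    intro p
    by_cases hp : ∃ f, (p, f) ∈ K
    · obtain ⟨m, hm, h⟩ := exists_forall_inner_sub_nonneg (hsec p) (hc p) hp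
      exact ⟨m, fun _ => ⟨hm, h⟩, fun h => absurd hp h⟩
    · exact ⟨0, fun h => absurd h hp, fun _ => rfl⟩
  choose m hm hm0 using hex
  refine ⟨m, ?_, fun p hp => (hm p hp).1⟩
  -- The quotients `a / b` run through the nonnegative rationals, so countably many radii suffice;
  -- `b = 0` only repeats radius `0`.
  set S : Set V → ℕ → ℕ → Set P := fun C a b =>
    {p | ∃ f ∈ C ∩ Metric.closedBall 0 ((a : ℝ) / b), (p, f) ∈ K} with hSdef
  have hS : ∀ C, IsClosed C → ∀ a b, MeasurableSet (S C a b) := fun C hC a b =>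
    (isClosed_setOf_exists_mem_isCompact hK
      ((isCompact_closedBall _ _).inter_left hC)).measurableSet
  set D : Set P := {p | ∃ f, (p, f) ∈ K} with hDdef
  have hD : MeasurableSet D := by
    have : D = ⋃ a, S univ a 1 := by
      ext p
      simp only [hDdef, hSdef, mem_ofPred_eq, mem_iUnion, univ_inter, mem_closedBall_zero_iff,
        Nat.cast_one, div_one]
      constructor
      · rintro ⟨f, hf⟩
        obtain ⟨a, ha⟩ := exists_nat_ge ‖f‖
        exact ⟨a, f, ha, hf⟩
      · rintro ⟨a, f, -, hf⟩
        exact ⟨f, hf⟩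
    rw [this]
    exact MeasurableSet.iUnion fun a => hS _ isClosed_univ _ _
  refine measurable_of_isClosed fun C hC => ?_
  -- Over `D`, `m p ∈ C` iff every rational ball about `0` that meets the section also meets its
  -- part in `C`; off `D`, `m` is `0`.
  have key : m ⁻¹' C = (D ∩ ⋂ a, ⋂ b, ((S univ a b)ᶜ ∪ S C a b)) ∪ (Dᶜ ∩ {_p | (0 : V) ∈ C}) := by
    ext p
    by_cases hp : p ∈ D
    · obtain ⟨hpm, hpi⟩ := hm p hp
      simp only [mem_preimage, mem_union, mem_inter_iff, hp, true_and, mem_compl_iff, not_true,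
        false_and, or_false, mem_iInter]
      constructor
      · intro hmC a b
        rw [← imp_iff_not_or]
        rintro ⟨f, ⟨-, hf⟩, hfK⟩
        refine ⟨m p, ⟨hmC, ?_⟩, hpm⟩
        rw [mem_closedBall_zero_iff] at hf ⊢
        exact (norm_le_of_inner_sub_nonneg (hpi f hfK)).trans hf
      · intro h
        have hcl : IsClosed (C ∩ {f | (p, f) ∈ K}) := hC.inter (hsec p)
        have happ : ∀ r > ‖m p‖, ∃ f ∈ C ∩ {f | (p, f) ∈ K}, ‖f‖ ≤ r := by
          intro r hr
          obtain ⟨q, hq1, hq2⟩ := exists_rat_btwn hr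
          have hq0 : 0 ≤ q := by exact_mod_cast (norm_nonneg (m p)).trans hq1.le
          have hq : (q : ℝ) = (q.num.toNat : ℝ) / q.den := by
            have h1 : ((q.num.toNat : ℤ) : ℝ) = (q.num : ℝ) := by
              rw [Int.toNat_of_nonneg (Rat.num_nonneg.2 hq0)]
            rw [Int.cast_natCast] at h1
            rw [h1, ← Rat.cast_def]
          have hmem : p ∈ S univ q.num.toNat q.den := by
            refine ⟨m p, ⟨mem_univ _, ?_⟩, hpm⟩
            rw [mem_closedBall_zero_iff, ← hq]
            exact hq1.le
          obtain ⟨f, ⟨hfC, hf⟩, hfK⟩ := (h q.num.toNat q.den).resolve_left (not_not.2 hmem)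
          rw [mem_closedBall_zero_iff, ← hq] at hf
          exact ⟨f, ⟨hfC, hfK⟩, hf.trans hq2.le⟩
        -- The point of `C` in the section nearest to `0` has norm at most `‖m p‖`, hence is `m p`.
        obtain ⟨f₀, hf₀, -⟩ := happ (‖m p‖ + 1) (by linarith)
        obtain ⟨g, hg, hgd⟩ := hcl.exists_infDist_eq_dist ⟨f₀, hf₀⟩ (0 : V)
        rw [dist_zero_left] at hgd
        have hgm : ‖g‖ ≤ ‖m p‖ := by
          refine le_of_forall_gt_imp_ge_of_dense fun r hr => ?_
          obtain ⟨f, hf, hfr⟩ := happ r hr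
          rw [← hgd]
          refine (Metric.infDist_le_dist_of_mem hf).trans ?_
          rwa [dist_zero_left]
        exact eq_of_inner_sub_nonneg (hpi g hg.2) hgm ▸ hg.1
    · simp [hp, hm0 p hp]
  rw [key]
  refine (hD.inter (MeasurableSet.iInter fun a => MeasurableSet.iInter fun b =>
    (hS _ isClosed_univ _ _).compl.union (hS _ hC _ _))).union (hD.compl.inter ?_)
  exact MeasurableSet.const _

variable {n : ℕ}

/-- By maximality, adjoining a monotonically related pair cannot enlarge the graph. The resulting
inequalities are closed in `(x, a)` and affine in `a`, whence closed graph and convex values. -/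
lemma IsMaximalMonotone.mem_iff {A : EuclideanSpace ℝ (Fin n) → Set (EuclideanSpace ℝ (Fin n))}
    (hA : IsMaximalMonotone A) (x a : EuclideanSpace ℝ (Fin n)) :
    a ∈ A x ↔ ∀ p ∈ graph A, 0 ≤ inner ℝ (a - p.2) (x - p.1) := by
  refine ⟨fun h p hp => hA.1 (x, a) h p hp, fun h => ?_⟩
  by_contra hax
  refine hA.2 (fun y => A y ∪ {b | y = x ∧ b = a}) ?_ ⟨fun p hp => Or.inl hp, fun hsub => ?_⟩
  · rintro ⟨y, b⟩ (hy | ⟨rfl, rfl⟩) ⟨z, c⟩ (hz | ⟨rfl, rfl⟩)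
    · exact hA.1 _ hy _ hz
    · have := h (y, b) hy
      rwa [← neg_sub, ← neg_sub z, inner_neg_neg]
    · exact h (z, c) hz
    · simp
  · exact hax (hsub (show (x, a) ∈ graph _ from Or.inr ⟨rfl, rfl⟩))

lemma IsMaximalMonotone.convex {A : EuclideanSpace ℝ (Fin n) → Set (EuclideanSpace ℝ (Fin n))}
    (hA : IsMaximalMonotone A) (x : EuclideanSpace ℝ (Fin n)) : Convex ℝ (A x) := by
  intro a ha b hb s t hs ht hst
  rw [hA.mem_iff] at ha hb ⊢
  intro p hp
  have : s • a + t • b - p.2 = s • (a - p.2) + t • (b - p.2) := by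
    rw [smul_sub, smul_sub, sub_add_sub_comm, ← add_smul, hst, one_smul]
  rw [this, inner_add_left, real_inner_smul_left, real_inner_smul_left]
  exact add_nonneg (mul_nonneg hs (ha p hp)) (mul_nonneg ht (hb p hp))

lemma IsMaximalMonotone.isClosed_graph
    {A : EuclideanSpace ℝ (Fin n) → Set (EuclideanSpace ℝ (Fin n))}
    (hA : IsMaximalMonotone A) : IsClosed (graph A) := by
  have : graph A = ⋂ p ∈ graph A, {q | 0 ≤ inner ℝ (q.2 - p.2) (q.1 - p.1)} := by
    ext q
    simp only [mem_iInter, mem_ofPred_eq]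
    exact hA.mem_iff q.1 q.2
  rw [this]
  exact isClosed_biInter fun p _ => isClosed_le continuous_const (by fun_prop)

lemma IsLipschitzCusco.isClosed_graph {L : ℝ≥0}
    {F : EuclideanSpace ℝ (Fin n) → Set (EuclideanSpace ℝ (Fin n))}
    (hF : IsLipschitzCusco L F) : IsClosed (graph F) := by
  have : graph F = ⋂ y, {q | Metric.infDist q.2 (F y) ≤ L * ‖q.1 - y‖} := by
    ext ⟨z, f⟩
    simp only [mem_iInter, mem_ofPred_eq]
    constructor
    · intro hf y
      obtain ⟨g, hg, b, hb, rfl⟩ := hF.lipschitz z y hf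
      refine (Metric.infDist_le_dist_of_mem hg).trans ?_
      simpa using hb
    · intro h
      have h0 := h z
      -- The constraint at `y = z` alone forces membership, since `F z` is closed.
      rw [sub_self, norm_zero, mul_zero] at h0
      exact ((hF.isCompact z).isClosed.mem_iff_infDist_zero (hF.nonempty z)).2
        (le_antisymm h0 Metric.infDist_nonneg)
  rw [this]
  refine isClosed_iInter fun y => isClosed_le ?_ (by fun_prop)
  exact (Metric.continuous_infDist_pt _).comp continuous_snd

/-- A Lipschitz multifunction with compact values maps bounded sets to bounded sets. -/
lemma IsLipschitzCusco.exists_norm_le {L : ℝ≥0}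
    {F : EuclideanSpace ℝ (Fin n) → Set (EuclideanSpace ℝ (Fin n))}
    (hF : IsLipschitzCusco L F) (R : ℝ) :
    ∃ M : ℝ, ∀ y, ‖y‖ ≤ R → ∀ f ∈ F y, ‖f‖ ≤ M := by
  obtain ⟨M, hM⟩ := (hF.isCompact 0).isBounded.exists_norm_le
  refine ⟨M + L * R, fun y hy f hf => ?_⟩
  obtain ⟨g, hg, b, hb, rfl⟩ := hF.lipschitz y 0 hf
  rw [mem_closedBall_zero_iff, sub_zero] at hb
  exact (norm_add_le g b).trans (add_le_add (hM g hg)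
    (hb.trans (mul_le_mul_of_nonneg_left hy L.coe_nonneg)))

/-- Along measurable functions `y` and `v`, the velocity `v` can be decomposed measurably as an
element of `F ∘ y` minus an element of `A ∘ y`, wherever such a decomposition exists. -/
theorem exists_measurable_decomposition {L : ℝ≥0}
    {F A : EuclideanSpace ℝ (Fin n) → Set (EuclideanSpace ℝ (Fin n))}
    (hF : IsLipschitzCusco L F) (hA : IsMaximalMonotone A)
    {T : Type*} [MeasurableSpace T] {y v : T → EuclideanSpace ℝ (Fin n)}
    (hy : Measurable y) (hv : Measurable v) :
    ∃ f : T → EuclideanSpace ℝ (Fin n), Measurable f ∧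
      ∀ t, v t ∈ F (y t) - A (y t) → f t ∈ F (y t) ∧ v t ∈ {f t} - A (y t) := by
  let K : Set ((EuclideanSpace ℝ (Fin n) × EuclideanSpace ℝ (Fin n)) × EuclideanSpace ℝ (Fin n)) :=
    {q | (q.1.1, q.2) ∈ graph F} ∩ {q | (q.1.1, q.2 - q.1.2) ∈ graph A}
  have hK : IsClosed K := (hF.isClosed_graph.preimage (by fun_prop)).inter
    (hA.isClosed_graph.preimage (by fun_prop))
  obtain ⟨m, hm, hmK⟩ := exists_measurable_selection hK fun p => by
    have : {f | (p, f) ∈ K} = F p.1 ∩ (fun z => -p.2 + z) ⁻¹' A p.1 := by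
      ext f
      simp [K, graph, neg_add_eq_sub]
    rw [this]
    exact (hF.convex p.1).inter ((hA.convex p.1).translate_preimage_right (-p.2))
  refine ⟨fun t => m (y t, v t), hm.comp (hy.prodMk hv), fun t ht => ?_⟩
  obtain ⟨f, hf, a, ha, hfa⟩ := ht
  have hfa' : f - v t = a := by rw [← hfa]; exact sub_sub_cancel f a
  obtain ⟨h1, h2⟩ := hmK (y t, v t) ⟨f, hf, show f - v t ∈ A (y t) from hfa' ▸ ha⟩
  exact ⟨h1, _, rfl, _, h2, sub_sub_cancel _ _⟩

end MonotoneInclusion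

open MonotoneInclusion in
theorem mainTheorem9 {n : ℕ} (L : ℝ≥0)
    (F A : EuclideanSpace ℝ (Fin n) → Set (EuclideanSpace ℝ (Fin n)))
    (hF : MonotoneInclusion.IsLipschitzCusco L F)
    (hA : MonotoneInclusion.IsMaximalMonotone A)
    (x₀ : EuclideanSpace ℝ (Fin n))
    (x : ℝ → EuclideanSpace ℝ (Fin n)) (hx : ContinuousOn x (Ici 0)) :
    MonotoneInclusion.IsSolution F A x₀ x ↔
      MonotoneInclusion.LocallyAbsolutelyContinuous x ∧
      ∀ T : ℝ, 0 < T →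
        ∃ f : ℝ → EuclideanSpace ℝ (Fin n),
          MemLp f ∞ (volume.restrict (Ioo 0 T)) ∧
          (∀ᵐ t ∂(volume.restrict (Icc 0 T)), f t ∈ F (x t)) ∧
          (∀ᵐ t ∂(volume.restrict (Icc 0 T)),
            DifferentiableAt ℝ x t ∧ deriv x t ∈ {f t} - A (x t)) ∧
          x 0 = x₀ ∧ x₀ ∈ closure (MonotoneInclusion.dom A) := by
  constructor
  · intro h
    refine ⟨h.absolutelyContinuous, fun T hT => ?_⟩
    -- Nothing is known of `x` at negative times, so a globally measurable copy replaces it.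
    obtain ⟨y, hy, hyx⟩ : ∃ y : ℝ → EuclideanSpace ℝ (Fin n), Measurable y ∧
        ∀ t ∈ Ici (0 : ℝ), y t = x t := by
      classical
      refine ⟨(Ici 0).piecewise x (fun _ => 0),
        hx.measurable_piecewise continuousOn_const measurableSet_Ici, fun t ht => ?_⟩
      exact piecewise_eq_of_mem _ _ _ ht
    obtain ⟨f, hfm, hf⟩ := exists_measurable_decomposition hF hA hy (measurable_deriv x)
    have hincl := ae_restrict_of_ae_restrict_of_subset
      (Icc_subset_Ici_self : Icc (0 : ℝ) T ⊆ Ici 0) h.inclusion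
    have hsel : ∀ᵐ t ∂(volume.restrict (Icc 0 T)), f t ∈ F (x t) ∧
        deriv x t ∈ {f t} - A (x t) := by
      filter_upwards [hincl, ae_restrict_mem measurableSet_Icc] with t ht htT
      have := hf t
      rw [hyx t htT.1] at this
      exact this ht.2
    refine ⟨f, ?_, hsel.mono fun t ht => ht.1, ?_, h.initial, h.initial_mem⟩
    · obtain ⟨R, hR⟩ := isCompact_Icc.exists_bound_of_continuousOn
        (hx.mono (Icc_subset_Ici_self : Icc (0 : ℝ) T ⊆ Ici 0))
      obtain ⟨M, hM⟩ := hF.exists_norm_le R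
      have : MemLp f ∞ (volume.restrict (Icc 0 T)) := by
        refine memLp_top_of_bound hfm.aestronglyMeasurable M ?_
        filter_upwards [hsel, ae_restrict_mem measurableSet_Icc] with t ht htT
        exact hM _ (hR t htT) _ ht.1
      exact this.mono_measure (Measure.restrict_mono Ioo_subset_Icc_self le_rfl)
    · filter_upwards [hincl, hsel] with t ht ht'
      exact ⟨ht.1, ht'.2⟩
  · rintro ⟨hac, h⟩
    obtain ⟨-, -, -, -, h0, hcl⟩ := h 1 one_pos
    refine ⟨hx, hac, ?_, h0, hcl⟩
    -- The shift by `1` keeps every horizon `T` positive.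
    have hcover : Ici (0 : ℝ) ⊆ ⋃ N : ℕ, Icc 0 ((N : ℝ) + 1) := by
      intro t ht
      obtain ⟨N, hN⟩ := exists_nat_ge t
      exact mem_iUnion.2 ⟨N, ht, by linarith⟩
    refine ae_restrict_of_ae_restrict_of_subset hcover ?_
    rw [ae_restrict_iUnion_iff]
    intro N
    obtain ⟨f, -, hf, hd, -⟩ := h (N + 1) (by positivity)
    filter_upwards [hf, hd] with t ht htd
    exact ⟨htd.1, sub_subset_sub_right (singleton_subset_iff.2 ht) htd.2⟩
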